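/- Let $d$ be a nonnegative integer and let $f:\mathbb R^d\to\mathbb R$ be a DC function, i.e. every $x\in\mathbb R^d$ has a convex neighbourhood $V$ on which $f=g-h$ for some convex functions $g,h:V\to\mathbb R$. For $x\in\mathbb R^d$ let the Clarke differential $\partial f(x)\subset\mathbb R^d$ be the convex hull of the set of all $\xi=\lim_{i\to\infty}\nabla f(x_i)$, where $x_1,x_2,\dots\to x$ is a sequence of points at which $f$ is differentiable and for which the limit exists. Then the graph $$\operatorname{graph}\partial f=\{(x,\xi)\in\mathbb R^d\times\mathbb R^d:\ \xi\in\partial f(x)\}$$ has locally finite $d$-dimensional Minkowski content, that is, for every compact $K\subset\mathbb R^d\times\mathbb R^d$ the set $S=K\cap\operatorname{graph}\partial f$ satisfies $$\limsup_{\varepsilon\downarrow0}\,(2\varepsilon)^{d-2d}\operatorname{Vol}(S_\varepsilon)<\infty,$$ where $S_\varepsilon$ denotes the set of points of $\mathbb R^{d}\times\mathbb R^d=\mathbb R^{2d}$ lying within Euclidean distance $\varepsilon$ of $S$. -/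

import Mathlib

open Filter Topology MeasureTheory

noncomputable section

/-- The `m`-dimensional upper Minkowski content of a subset `S` of an `n`-dimensional Euclidean
space: the upper limit, as `ε ↓ 0`, of `(2ε)^(m-n) * Vol(S_ε)`, where `S_ε` is the set of points
within distance `ε` of `S`. -/
def upperMinkowskiContent {X : Type*} [NormedAddCommGroup X] [InnerProductSpace ℝ X]
    [FiniteDimensional ℝ X] [MeasurableSpace X] [BorelSpace X] (m : ℕ) (S : Set X) : ENNReal :=
  limsup (fun ε : ℝ =>
      ENNReal.ofReal ((2 * ε) ^ ((m : ℤ) - (Module.finrank ℝ X : ℤ))) *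
        volume (Metric.cthickening ε S))
    (𝓝[>] 0)

/-- `S` has finite `m`-content. -/
def HasFiniteContent {X : Type*} [NormedAddCommGroup X] [InnerProductSpace ℝ X]
    [FiniteDimensional ℝ X] [MeasurableSpace X] [BorelSpace X] (m : ℕ) (S : Set X) : Prop :=
  upperMinkowskiContent m S < ⊤

/-- `S` has locally finite `m`-content: its intersection with every compact subset of the ambient
space has finite `m`-content. -/
def HasLocallyFiniteContent {X : Type*} [NormedAddCommGroup X] [InnerProductSpace ℝ X]
    [FiniteDimensional ℝ X] [MeasurableSpace X] [BorelSpace X] (m : ℕ) (S : Set X) : Prop :=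
  ∀ K : Set X, IsCompact K → HasFiniteContent m (S ∩ K)

/-- `f` is DC on the open set `U`: near each point of `U` it is a difference of two convex
functions, on some convex neighbourhood of the point contained in `U`. -/
def IsDCOn {E : Type*} [NormedAddCommGroup E] [NormedSpace ℝ E] (U : Set E) (f : E → ℝ) : Prop :=
  ∀ x ∈ U, ∃ V ∈ 𝓝 x, V ⊆ U ∧ Convex ℝ V ∧
    ∃ g h : E → ℝ, ConvexOn ℝ V g ∧ ConvexOn ℝ V h ∧ ∀ y ∈ V, f y = g y - h y

/-- The Clarke differential of `f` at `x`, as a set of vectors (covectors are identified with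
vectors by the inner product): the convex hull of all limits of gradients `∇ f (x i)` along
sequences `x i → x` of points of differentiability of `f`. -/
def clarkeDifferential {E : Type*} [NormedAddCommGroup E] [InnerProductSpace ℝ E]
    [CompleteSpace E] (f : E → ℝ) (x : E) : Set E :=
  convexHull ℝ {ξ : E | ∃ u : ℕ → E, Tendsto u atTop (𝓝 x) ∧
    (∀ i, DifferentiableAt ℝ f (u i)) ∧ Tendsto (fun i => gradient f (u i)) atTop (𝓝 ξ)}

/-- The graph `{(x, ξ) : ξ ∈ ∂f(x)}` of the Clarke differential, in the product `E × E` with the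
Euclidean (`L²`) product norm. -/
def clarkeGraph {E : Type*} [NormedAddCommGroup E] [InnerProductSpace ℝ E]
    [CompleteSpace E] (f : E → ℝ) : Set (WithLp 2 (E × E)) :=
  {p | p.snd ∈ clarkeDifferential f p.fst}

end

/-! Near a point write f = g - h and add ‖y‖²/2 to g and h: this gives strongly convex G, H with f =
G - H, and ∂f(x) lies in the differences ξ - η of subgradients. Let D(x) be the ε²-subdifferential
of G + H at x. It contains an ε-ball and stays in a fixed ball of radius R.

Shrink each D(x) by 1/2 towards a centre to get its core, and choose a maximal disjoint family of
cores, with base points i; their total volume is at most that of the R-ball. If the core at x meets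
the core at i, then i lies in the caps at x (`cap_bound_of_core_mem`). Hence ‖x - i‖ = O(ε), and
approximate subgradients at x remain so at i (`transfer_of_cap`). The ε-neighbourhood of the graph
over x then lies in B(i, O(ε)) × a dilate of D(i) (`sub_mem_dilate_core`). Summing over i gives
volume O(ε^d). -/

/-- The `δ`-subdifferential at `x` of `φ` regarded as a function on `W`. -/
def approxSubdifferential {E : Type*} [NormedAddCommGroup E] [InnerProductSpace ℝ E]
    (W : Set E) (φ : E → ℝ) (δ : ℝ) (x : E) : Set E :=
  {ζ | ∀ y ∈ W, φ x + inner ℝ ζ (y - x) - δ ≤ φ y}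

/-- The slopes at `x` of the quadratic minorants with unit second derivative of `φ` on `W`. -/
def strongSubdifferential {E : Type*} [NormedAddCommGroup E] [InnerProductSpace ℝ E]
    (W : Set E) (φ : E → ℝ) (x : E) : Set E :=
  {ξ | ∀ y ∈ W, φ x + inner ℝ ξ (y - x) + ‖y - x‖ ^ 2 / 2 ≤ φ y}

/-! ### Approximate subdifferentials and centres of convex bodies -/

section
variable {E : Type*} [NormedAddCommGroup E] [InnerProductSpace ℝ E]

theorem convex_approxSubdifferential (W : Set E) (φ : E → ℝ) (δ : ℝ) (x : E) :
    Convex ℝ (approxSubdifferential W φ δ x) := by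
  intro ζ hζ ω hω a b ha hb hab y hy
  have h1 := mul_le_mul_of_nonneg_left (hζ y hy) ha
  have h2 := mul_le_mul_of_nonneg_left (hω y hy) hb
  rw [inner_add_left, real_inner_smul_left, real_inner_smul_left]
  obtain rfl : b = 1 - a := by linarith
  linarith

theorem isClosed_approxSubdifferential (W : Set E) (φ : E → ℝ) (δ : ℝ) (x : E) :
    IsClosed (approxSubdifferential W φ δ x) := by
  simp only [approxSubdifferential, Set.ofPred_forall]
  exact isClosed_biInter fun y _ => isClosed_le (by fun_prop) continuous_const

/-- A point `p` of a compact convex set such that every chord through `p` is divided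
by `p` in a ratio of at most `finrank ℝ E`. -/
theorem exists_minkowski_center [FiniteDimensional ℝ E] {D : Set E} (hD : Convex ℝ D)
    (hc : IsCompact D) (hne : D.Nonempty) :
    ∃ p ∈ D, ∀ ζ ∈ D, ∃ ω ∈ D,
      ((Module.finrank ℝ E : ℝ) + 1) • p = (Module.finrank ℝ E : ℝ) • ω + ζ := by
  classical
  set d := Module.finrank ℝ E
  have hd : (0 : ℝ) < d + 1 := by positivity
  let F : D → Set E := fun ζ =>
    (fun ω : E => ((d : ℝ) + 1)⁻¹ • ((d : ℝ) • ω + (ζ : E))) '' D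
  -- `F ζ` is `D` contracted towards `ζ` by d/(d+1). By Helly it suffices that any d+1 of these sets
  -- meet: they share the mean of their d+1 centres, padded with copies of `z` when there are fewer.
  have hF : (⋂ ζ, F ζ).Nonempty := by
    refine Convex.helly_theorem_compact' (𝕜 := ℝ) ?_ ?_ ?_
    · rintro ζ _ ⟨x, hx, rfl⟩ _ ⟨y, hy, rfl⟩ a b ha hb hab
      refine ⟨a • x + b • y, hD hx hy ha hb hab, ?_⟩
      obtain rfl : b = 1 - a := by linarith
      dsimp only
      module
    · exact fun ζ => hc.image (by fun_prop)
    · intro I hI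
      obtain ⟨z, hz⟩ := hne
      have hdI : (0 : ℝ) ≤ d + 1 - (I.card : ℝ) := by
        have : (I.card : ℝ) ≤ d + 1 := by exact_mod_cast hI
        linarith
      refine ⟨((d : ℝ) + 1)⁻¹ • (∑ i ∈ I, (i : E) + ((d : ℝ) + 1 - I.card) • z), ?_⟩
      simp only [Set.mem_iInter]
      intro j hj
      have hs : (∑ i ∈ I, (i : E)) = ∑ i ∈ I.erase j, (i : E) + j :=
        (Finset.sum_erase_add I _ hj).symm
      have hcard : ((I.erase j).card : ℝ) = I.card - 1 := by
        rw [Finset.card_erase_of_mem hj, Nat.cast_pred (Finset.card_pos.2 ⟨j, hj⟩)]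
      rcases Nat.eq_zero_or_pos d with h0 | h0
      · have hI1 : I.card = 1 := by
          have := Finset.card_pos.2 ⟨j, hj⟩
          omega
        refine ⟨z, hz, ?_⟩
        obtain ⟨k, rfl⟩ := Finset.card_eq_one.1 hI1
        obtain rfl := Finset.mem_singleton.1 hj
        simp [h0]
      · have hdp : (0 : ℝ) < d := by exact_mod_cast h0
        refine ⟨(d : ℝ)⁻¹ • (∑ i ∈ I.erase j, (i : E) + ((d : ℝ) + 1 - I.card) • z), ?_, ?_⟩
        · have hm := hD.sum_mem (t := (Finset.insertNone (I.erase j)))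
            (w := fun o : Option D => o.elim ((d : ℝ)⁻¹ * ((d : ℝ) + 1 - I.card)) fun _ => (d : ℝ)⁻¹)
            (z := fun o : Option D => o.elim z fun i => (i : E)) ?_ ?_ ?_
          · simp only [Finset.sum_insertNone, Option.elim] at hm
            rw [smul_add, Finset.smul_sum, smul_smul, add_comm]
            exact hm
          · rintro (_ | i) _
            · exact mul_nonneg (by positivity) hdI
            · exact inv_nonneg.2 hdp.le
          · simp only [Finset.sum_insertNone, Option.elim, Finset.sum_const, nsmul_eq_mul, hcard]
            field_simp
            ring
          · rintro (_ | i) _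
            · exact hz
            · exact i.2
        · dsimp only
          rw [smul_smul, mul_inv_cancel₀ hdp.ne', one_smul, hs]
          congr 1
          abel
  obtain ⟨p, hp⟩ := hF
  simp only [Set.mem_iInter] at hp
  have key : ∀ ζ ∈ D, ∃ ω ∈ D, ((d : ℝ) + 1) • p = (d : ℝ) • ω + ζ := by
    intro ζ hζ
    obtain ⟨ω, hω, h⟩ := hp ⟨ζ, hζ⟩
    refine ⟨ω, hω, ?_⟩
    rw [← h]
    exact smul_inv_smul₀ hd.ne' _
  refine ⟨p, ?_, key⟩
  obtain ⟨ζ, hζ⟩ := hne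
  obtain ⟨ω, hω, h⟩ := key ζ hζ
  have : p = ((d : ℝ) / (d + 1)) • ω + (1 / ((d : ℝ) + 1)) • ζ := by
    rw [← inv_smul_smul₀ hd.ne' p, h, smul_add, smul_smul, div_eq_inv_mul, one_div]
  rw [this]
  exact hD hω hζ (by positivity) (by positivity) (by field_simp)

end

/-! ### Caps and transfer of approximate subgradients -/

section
variable {E : Type*} [NormedAddCommGroup E] [InnerProductSpace ℝ E]

/-- If a point half way between the center `p` of `approxSubdifferential W φ δ x` and another of its
points is a `δ`-subgradient at `i`, then `i` lies in the caps at `x` of all its `δ`-subgradients. -/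
theorem cap_bound_of_core_mem {W : Set E} {φ : E → ℝ} {δ d : ℝ} (hδ : 0 ≤ δ) (hd : 0 ≤ d) {x i : E}
    (hx : x ∈ W) (hi : i ∈ W) {p ζ ζ₁ : E}
    (hp : ∀ ζ ∈ approxSubdifferential W φ δ x, ∃ ω ∈ approxSubdifferential W φ δ x,
      (d + 1) • p = d • ω + ζ)
    (hζ : ζ ∈ approxSubdifferential W φ δ x)
    (hζi : (1 / 2 : ℝ) • p + (1 / 2 : ℝ) • ζ ∈ approxSubdifferential W φ δ i)
    (hζ₁ : ζ₁ ∈ approxSubdifferential W φ δ x) :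
    φ i ≤ φ x + inner ℝ ζ₁ (i - x) + 4 * (d + 1) * δ := by
  -- Expanding `p` puts weight 1/(2(d+1)) on `ζ₁` in the midpoint. The slopes `ζ` and `ω` carry the
  -- rest and are bounded by `φ i - φ x + δ`; solving for `φ i` leaves an error (4d+3)δ.
  obtain ⟨ω, hω, hpω⟩ := hp ζ₁ hζ₁
  have h1 := hζi x hx
  have h2 := hζ i hi
  have h3 := mul_le_mul_of_nonneg_left (hω i hi) hd
  have h4 := congrArg (fun v => inner ℝ v (i - x)) hpω
  simp only [inner_add_left, real_inner_smul_left] at h1 h4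
  rw [← neg_sub i x, inner_neg_right, inner_neg_right] at h1
  have h5 := mul_le_mul_of_nonneg_left h1 (by linarith : 0 ≤ 2 * (d + 1))
  have h6 := mul_le_mul_of_nonneg_left h2 (by linarith : 0 ≤ d + 1)
  nlinarith [mul_nonneg hd hδ]

theorem add_mem_approxSubdifferential {W : Set E} {G H : E → ℝ} {x ξ η : E} {δ : ℝ}
    (hξ : ξ ∈ approxSubdifferential W G δ x) (hη : η ∈ strongSubdifferential W H x) :
    ξ + η ∈ approxSubdifferential W (fun y => G y + H y) δ x := by
  intro y hy
  have h1 := hξ y hy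
  have h2 := hη y hy
  rw [inner_add_left]
  nlinarith [sq_nonneg ‖y - x‖]

/-- The quadratic term pays for `e`, since εt ≤ ε²/2 + t²/2. This absorbs the ε-thickening in the
gradient variable. -/
theorem add_mem_approxSubdifferential_of_strong {W : Set E} {G : E → ℝ} {x ξ e : E} {ε : ℝ}
    (hξ : ξ ∈ strongSubdifferential W G x) (he : ‖e‖ ≤ ε) :
    ξ + e ∈ approxSubdifferential W G (ε ^ 2) x := by
  intro y hy
  have h1 := hξ y hy
  have h2 := real_inner_le_norm e (y - x)
  have h3 : ‖e‖ * ‖y - x‖ ≤ ε * ‖y - x‖ := by gcongr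
  rw [inner_add_left]
  nlinarith [sq_nonneg (‖y - x‖ - ε), sq_nonneg ε]

/-- The two quadratic minorants add up to ‖i - x‖², so the cap inequality forces ‖i - x‖² ≤ cε². -/
theorem norm_sub_le_of_cap {W : Set E} {G H : E → ℝ} {x i ξ η : E} {c ε : ℝ} (hc : 1 ≤ c)
    (hε : 0 ≤ ε) (hi : i ∈ W)
    (hξ : ξ ∈ strongSubdifferential W G x) (hη : η ∈ strongSubdifferential W H x)
    (h : G i + H i ≤ G x + H x + inner ℝ (ξ + η) (i - x) + c * ε ^ 2) :
    ‖x - i‖ ≤ c * ε := by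
  have h1 := hξ i hi
  have h2 := hη i hi
  rw [inner_add_left] at h
  rw [norm_sub_rev]
  have h3 : 0 ≤ c * (c - 1) * ε ^ 2 := by
    have := sub_nonneg.2 hc
    positivity
  have h4 : ‖i - x‖ ^ 2 ≤ (c * ε) ^ 2 := by linarith
  exact (sq_le_sq₀ (norm_nonneg _) (by positivity)).1 h4

/-- If the sum of two lower bounds is nearly attained at `i`, each is nearly attained there, so both
slopes can be rebased from `x` to `i`. -/
theorem transfer_of_cap {W : Set E} {G H : E → ℝ} {x i ξ η : E} {c δ : ℝ} (hi : i ∈ W)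
    (hξ : ξ ∈ approxSubdifferential W G δ x) (hη : η ∈ strongSubdifferential W H x)
    (h : G i + H i ≤ G x + H x + inner ℝ (ξ + η) (i - x) + c * δ) :
    ξ ∈ approxSubdifferential W G ((c + 1) * δ) i ∧
      η ∈ approxSubdifferential W H ((c + 1) * δ) i := by
  have h1 := hξ i hi
  have h2 := hη i hi
  rw [inner_add_left] at h
  have hq := sq_nonneg ‖i - x‖
  constructor
  · intro y hy
    have h3 := hξ y hy
    rw [show y - i = (y - x) - (i - x) by abel, inner_sub_right]
    linarith
  · intro y hy
    have h3 := hη y hy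
    have hq' := sq_nonneg ‖y - x‖
    rw [show y - i = (y - x) - (i - x) by abel, inner_sub_right]
    linarith

theorem exists_eq_add_smul_of_mem_approxSubdifferential {W : Set E} {φ : E → ℝ} {c δ : ℝ}
    (hc : 0 < c) {i ζ₀ v : E} (hζ₀ : ∀ y ∈ W, φ i + inner ℝ ζ₀ (y - i) ≤ φ y) (hc1 : 1 ≤ c)
    (hv : v ∈ approxSubdifferential W φ (c * δ) i) :
    ∃ ζ ∈ approxSubdifferential W φ δ i, v = ζ₀ + c • (ζ - ζ₀) := by
  refine ⟨ζ₀ + c⁻¹ • (v - ζ₀), ?_, by rw [add_sub_cancel_left, smul_inv_smul₀ hc.ne']; abel⟩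
  intro y hy
  have h1 := mul_le_mul_of_nonneg_left (hv y hy) (inv_pos.2 hc).le
  have h2 := mul_le_mul_of_nonneg_left (hζ₀ y hy) (sub_nonneg.2 (inv_le_one_of_one_le₀ hc1))
  have h3 : c⁻¹ * (c * δ) = δ := inv_mul_cancel_left₀ hc.ne' δ
  rw [inner_add_left, real_inner_smul_left, inner_sub_left]
  linarith

/-- Differences of approximate subgradients of `G` and `H` lie in a dilate of the core of the
approximate subdifferential of `G + H`. -/
theorem sub_mem_dilate_core {W : Set E} {G H : E → ℝ} {c δ d : ℝ} (hc : 1 ≤ c) (hd : 0 ≤ d)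
    {i p ξ η a b : E}
    (hp : ∀ ζ ∈ approxSubdifferential W (fun y => G y + H y) δ i,
      ∃ ω ∈ approxSubdifferential W (fun y => G y + H y) δ i, (d + 1) • p = d • ω + ζ)
    (hξ : ξ ∈ strongSubdifferential W G i) (hη : η ∈ strongSubdifferential W H i)
    (ha : a ∈ approxSubdifferential W G (c * δ) i) (hb : b ∈ approxSubdifferential W H (c * δ) i) :
    ∃ m ∈ approxSubdifferential W (fun y => G y + H y) δ i,
      a - b = ξ - η - (c * (d + 1)) • p + (c * (d + 1)) • m := by
  have h0 : ∀ y ∈ W, G i + H i + inner ℝ (ξ + η) (y - i) ≤ G y + H y := by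
    intro y hy
    have h1 := hξ y hy
    have h2 := hη y hy
    rw [inner_add_left]
    nlinarith [sq_nonneg ‖y - i‖]
  have hc0 : 0 < c := by linarith
  have ha' := add_mem_approxSubdifferential ha hη
  have hb' : b + ξ ∈ approxSubdifferential W (fun y => G y + H y) (c * δ) i := by
    simpa only [add_comm (H _)] using add_mem_approxSubdifferential hb hξ
  obtain ⟨ζ, hζ, h1⟩ := exists_eq_add_smul_of_mem_approxSubdifferential hc0
    (φ := fun y => G y + H y) h0 hc ha'
  obtain ⟨ζ', hζ', h2⟩ := exists_eq_add_smul_of_mem_approxSubdifferential hc0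
    (φ := fun y => G y + H y) h0 hc hb'
  -- Here a - b = ξ - η + c(ζ - ζ'). The centre replaces -ζ' by dω - (d+1)p, so no reflected copy of
  -- the body is needed.
  obtain ⟨ω, hω, h3⟩ := hp ζ' hζ'
  have hd1 : 0 < d + 1 := by linarith
  refine ⟨(1 / (d + 1)) • ζ + (d / (d + 1)) • ω,
    convex_approxSubdifferential _ _ _ _ hζ hω (by positivity) (by positivity) (by field_simp; ring),
    ?_⟩
  have e1 : (c * (d + 1)) • ((1 / (d + 1)) • ζ + (d / (d + 1)) • ω) = c • (ζ + d • ω) := by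
    rw [smul_add, smul_smul, smul_smul, smul_add, smul_smul]
    congr 2 <;> field_simp
  have e2 : (c * (d + 1)) • p = c • (d • ω + ζ') := by rw [mul_smul, h3]
  rw [e1, e2, eq_sub_of_add_eq h1, eq_sub_of_add_eq h2]
  module

end

/-! ### The covering argument -/

section
variable {E : Type*} [NormedAddCommGroup E] [InnerProductSpace ℝ E] [FiniteDimensional ℝ E]
  [MeasurableSpace E] [BorelSpace E]

open Pointwise in
theorem volume_image_add_smul (a : E) (r : ℝ) (s : Set E) :
    volume ((fun z => a + r • z) '' s) =
      ENNReal.ofReal (|r| ^ Module.finrank ℝ E) * volume s := by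
  rw [← abs_pow, ← Measure.addHaar_smul, ← measure_vadd volume a (r • s)]
  congr 1
  ext z
  simp [Set.mem_vadd_set, Set.mem_smul_set]

open Metric in
/-- The graph of a difference of two strong subdifferentials with bounded approximate
subdifferentials has finite Minkowski content in dimension `finrank ℝ E`. -/
theorem exists_volume_thickening_le {W P : Set E} {G H : E → ℝ} {R : ℝ} (hPW : P ⊆ W)
    (hG : ∀ x ∈ P, (strongSubdifferential W G x).Nonempty)
    (hH : ∀ x ∈ P, (strongSubdifferential W H x).Nonempty)
    (hR : ∀ x ∈ P, approxSubdifferential W (fun y => G y + H y) 1 x ⊆ closedBall 0 R)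
    {T : Set (WithLp 2 (E × E))}
    (hT : ∀ q ∈ T, q.fst ∈ P ∧ ∃ ξ ∈ strongSubdifferential W G q.fst,
      ∃ η ∈ strongSubdifferential W H q.fst, q.snd = ξ - η) :
    ∃ C : ENNReal, C ≠ ⊤ ∧ ∀ ε : ℝ, 0 < ε → ε ≤ 1 →
      volume (thickening ε T) ≤ C * ENNReal.ofReal (ε ^ Module.finrank ℝ E) := by
  set n := Module.finrank ℝ E with hn
  set c : ℝ := 4 * (n + 1) with hc
  have hn0 : (0 : ℝ) ≤ n := by positivity
  have hc1 : 1 ≤ c := by linarith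
  set κ : ℝ := (c + 1) * (n + 1) with hκ
  have hκ0 : 0 ≤ κ := by positivity
  refine ⟨ENNReal.ofReal ((c + 1) ^ n) * volume (closedBall (0 : E) 1) *
    (ENNReal.ofReal (κ ^ n) * (ENNReal.ofReal (2 ^ n) * volume (closedBall (0 : E) R))), ?_, ?_⟩
  · have h1 : volume (closedBall (0 : E) 1) ≠ ⊤ := measure_closedBall_lt_top.ne
    have h2 : volume (closedBall (0 : E) R) ≠ ⊤ := measure_closedBall_lt_top.ne
    finiteness
  intro ε hε hε1
  have hδ1 : ε ^ 2 ≤ 1 := pow_le_one₀ hε.le hε1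
  set D : E → Set E := approxSubdifferential W (fun y => G y + H y) (ε ^ 2) with hD
  have hDR : ∀ x ∈ P, D x ⊆ closedBall 0 R := fun x hx ζ hζ =>
    hR x hx fun y hy => (by linarith : _ ≤ _).trans (hζ y hy)
  choose! ξ₀ hξ₀ using hG
  choose! η₀ hη₀ using hH
  have hball : ∀ x ∈ P, closedBall (ξ₀ x + η₀ x) ε ⊆ D x := by
    intro x hx ζ hζ
    rw [mem_closedBall, dist_eq_norm] at hζ
    have := add_mem_approxSubdifferential
      (add_mem_approxSubdifferential_of_strong (hξ₀ x hx) hζ) (hη₀ x hx)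
    convert this using 1
    abel
  have hDcomp : ∀ x ∈ P, IsCompact (D x) := fun x hx =>
    (isCompact_closedBall 0 R).of_isClosed_subset
      (isClosed_approxSubdifferential _ _ _ _) (hDR x hx)
  have hDne : ∀ x ∈ P, (D x).Nonempty := fun x hx =>
    ⟨_, hball x hx (mem_closedBall_self hε.le)⟩
  have hcenter : ∀ x ∈ P, ∃ p ∈ D x, ∀ ζ ∈ D x, ∃ ω ∈ D x,
      ((n : ℝ) + 1) • p = (n : ℝ) • ω + ζ := fun x hx =>
    exists_minkowski_center (convex_approxSubdifferential _ _ _ _) (hDcomp x hx) (hDne x hx)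
  choose! p hpD hp using hcenter
  set core : E → Set E := fun x => (fun ζ => (1 / 2 : ℝ) • p x + (1 / 2 : ℝ) • ζ) '' D x with hcore
  have hcoreD : ∀ x ∈ P, core x ⊆ D x := by
    rintro x hx _ ⟨ζ, hζ, rfl⟩
    exact convex_approxSubdifferential _ _ _ _ (hpD x hx) hζ (by norm_num) (by norm_num)
      (by norm_num)
  have hcorevol : ∀ x, volume (D x) = ENNReal.ofReal (2 ^ n) * volume (core x) := by
    intro x
    rw [hcore]
    simp only [volume_image_add_smul]
    rw [← mul_assoc, ← ENNReal.ofReal_mul (by positivity), ← hn, abs_of_pos (by norm_num),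
      ← mul_pow]
    norm_num
  have hcoremeas : ∀ x ∈ P, MeasurableSet (core x) := fun x hx =>
    ((hDcomp x hx).image (by fun_prop)).measurableSet
  -- With constant size function 1, only maximality matters: every core meets a selected one.
  obtain ⟨I, hIP, hIdisj, hI⟩ := Vitali.exists_disjoint_subfamily_covering_enlargement core P
    (fun _ => 1) 2 one_lt_two (fun _ _ => zero_le_one) 1 (fun _ _ => le_rfl)
    (fun x hx => (hDne x hx).image _)
  have hIc : I.Countable := by
    have h := Measure.countable_meas_pos_of_disjoint_iUnion (μ := volume)
      (As := fun i : I => core i) (fun i => hcoremeas _ (hIP i.2)) (hIdisj.on_injective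
        Subtype.val_injective (fun i => i.2))
    have h2 : {i : I | 0 < volume (core i)} = Set.univ := by
      refine Set.eq_univ_of_forall fun i => ?_
      have h3 : 0 < volume (D i) := (measure_closedBall_pos volume _ hε).trans_le
        (measure_mono (hball i (hIP i.2)))
      rw [hcorevol] at h3
      exact pos_of_mul_pos_right h3 zero_le
    rw [h2] at h
    exact Set.countable_univ_iff.1 h
  have hsum : ∑' i : I, volume (core i) ≤ volume (closedBall (0 : E) R) := by
    rw [← measure_biUnion hIc hIdisj fun i hi => hcoremeas i (hIP hi)]
    exact measure_mono (Set.iUnion₂_subset fun i hi => (hcoreD i (hIP hi)).trans (hDR i (hIP hi)))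
  set B : E → Set E := fun i => (fun z => (ξ₀ i - η₀ i - κ • p i) + κ • z) '' D i with hB
  have hcover : thickening ε T ⊆ ⋃ i ∈ I,
      WithLp.ofLp ⁻¹' (closedBall i ((c + 1) * ε) ×ˢ B i) := by
    intro z hz
    obtain ⟨q, hq, hzq⟩ := mem_thickening_iff.1 hz
    obtain ⟨hqP, ξ, hξ, η, hη, hqs⟩ := hT q hq
    obtain ⟨i, hi, ⟨_, ⟨ζ, hζ, rfl⟩, hζi⟩, -⟩ := hI _ hqP
    have hiP := hIP hi
    have hcap : ∀ ζ₁ ∈ D q.fst, G i + H i ≤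
        G q.fst + H q.fst + inner ℝ ζ₁ (i - q.fst) + c * ε ^ 2 := fun ζ₁ hζ₁ =>
      cap_bound_of_core_mem (φ := fun y => G y + H y) (sq_nonneg ε) hn0 (hPW hqP) (hPW hiP)
        (hp _ hqP) hζ (hcoreD i hiP hζi) hζ₁
    have he : ‖z.snd - q.snd‖ ≤ ε := by
      rw [← dist_eq_norm]
      exact (WithLp.dist_snd_le z q).trans hzq.le
    have hx : dist z.fst q.fst ≤ ε := (WithLp.dist_fst_le z q).trans hzq.le
    have hξa : ξ + 0 ∈ approxSubdifferential W G (ε ^ 2) q.fst :=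
      add_mem_approxSubdifferential_of_strong hξ (by simpa using hε.le)
    rw [add_zero] at hξa
    have hξe := add_mem_approxSubdifferential_of_strong hξ he
    have h1 : ‖q.fst - i‖ ≤ c * ε := norm_sub_le_of_cap hc1 hε.le (hPW hiP) hξ hη
      (hcap _ (add_mem_approxSubdifferential hξa hη))
    obtain ⟨ha, hb⟩ := transfer_of_cap (hPW hiP) hξe hη
      (hcap _ (add_mem_approxSubdifferential hξe hη))
    obtain ⟨m, hm, h2⟩ := sub_mem_dilate_core (by linarith) hn0 (hp i hiP) (hξ₀ i hiP)
      (hη₀ i hiP) ha hb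
    refine Set.mem_biUnion hi ⟨?_, m, hm, ?_⟩
    · rw [mem_closedBall]
      rw [← dist_eq_norm] at h1
      have := dist_triangle z.fst q.fst i
      change dist z.fst i ≤ _
      linarith
    · change _ = z.snd
      dsimp only
      rw [hκ, ← h2, hqs]
      abel
  have hBvol : ∀ i, volume (B i) = ENNReal.ofReal (κ ^ n) * volume (D i) := fun i => by
    rw [hB]
    simp only [volume_image_add_smul]
    rw [abs_of_nonneg hκ0]
  calc volume (thickening ε T)
      ≤ ∑' i : I, volume (WithLp.ofLp ⁻¹' (closedBall (i : E) ((c + 1) * ε) ×ˢ B i) :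
          Set (WithLp 2 (E × E))) := (measure_mono hcover).trans (measure_biUnion_le _ hIc _)
    _ = ∑' i : I, ENNReal.ofReal ((c + 1) ^ n) * volume (closedBall (0 : E) 1) *
          (ENNReal.ofReal (κ ^ n) * ENNReal.ofReal (2 ^ n)) * ENNReal.ofReal (ε ^ n) *
            volume (core i) := by
        refine tsum_congr fun i => ?_
        have hBm : MeasurableSet (B i) :=
          ((hDcomp i (hIP i.2)).image (by fun_prop)).measurableSet
        rw [(WithLp.volume_preserving_ofLp E E).measure_preimage
          (isClosed_closedBall.measurableSet.prod hBm).nullMeasurableSet, Measure.volume_eq_prod,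
          Measure.prod_prod, Measure.addHaar_closedBall' _ _ (by positivity), hBvol, hcorevol,
          mul_pow, ENNReal.ofReal_mul (by positivity)]
        ring
    _ ≤ _ := by
        rw [ENNReal.tsum_mul_left]
        refine (mul_le_mul_right hsum _).trans (le_of_eq ?_)
        ring

end

/-! ### Subgradients of convex functions and the Clarke differential -/

section
variable {E : Type*} [NormedAddCommGroup E] [InnerProductSpace ℝ E]

theorem approxSubdifferential_mono {W W' : Set E} (h : W ⊆ W') {φ : E → ℝ} {δ δ' : ℝ}
    (hδ : δ' ≤ δ) (x : E) :
    approxSubdifferential W' φ δ' x ⊆ approxSubdifferential W φ δ x := fun _ hζ y hy =>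
  (by linarith : _ ≤ _).trans (hζ y (h hy))

theorem add_self_mem_strongSubdifferential {W : Set E} {φ : E → ℝ} {x η : E}
    (hη : η ∈ approxSubdifferential W φ 0 x) :
    η + x ∈ strongSubdifferential W (fun y => φ y + ‖y‖ ^ 2 / 2) x := by
  intro y hy
  have h1 := hη y hy
  have h2 := norm_sub_sq_real y x
  rw [inner_add_left, inner_sub_right x y x, real_inner_self_eq_norm_sq, real_inner_comm y x]
  rw [h2]
  linarith

open Metric in
-- A step of length `r` from `x` along `ζ` stays in the larger ball, where `φ` is bounded.
theorem exists_approxSubdifferential_subset_closedBall [FiniteDimensional ℝ E] {x₀ : E} {r : ℝ}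
    (hr : 0 < r) {φ : E → ℝ} (hφ : ContinuousOn φ (closedBall x₀ (2 * r))) :
    ∃ R, ∀ x ∈ closedBall x₀ r,
      approxSubdifferential (closedBall x₀ (2 * r)) φ 1 x ⊆ closedBall 0 R := by
  obtain ⟨M, hM⟩ := (isCompact_closedBall x₀ (2 * r)).exists_bound_of_continuousOn hφ
  have hM0 : 0 ≤ M := (norm_nonneg _).trans (hM x₀ (mem_closedBall_self (by linarith)))
  refine ⟨(2 * M + 1) / r, fun x hx ζ hζ => ?_⟩
  rw [mem_closedBall_zero_iff]
  rcases eq_or_ne ζ 0 with rfl | h0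
  · rw [norm_zero]
    positivity
  have hn : 0 < ‖ζ‖ := norm_pos_iff.2 h0
  rw [mem_closedBall, dist_eq_norm] at hx
  have hy : x + (r / ‖ζ‖) • ζ ∈ closedBall x₀ (2 * r) := by
    rw [mem_closedBall, dist_eq_norm, add_sub_right_comm]
    refine (norm_add_le _ _).trans ?_
    rw [norm_smul, Real.norm_of_nonneg (by positivity), div_mul_cancel₀ _ hn.ne']
    linarith
  have h1 := hζ _ hy
  have h2 := abs_le.1 (hM _ hy)
  have h3 := abs_le.1 (hM x (by rw [mem_closedBall, dist_eq_norm]; linarith))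
  rw [add_sub_cancel_left, real_inner_smul_right, real_inner_self_eq_norm_sq] at h1
  have h4 : r / ‖ζ‖ * ‖ζ‖ ^ 2 = r * ‖ζ‖ := by field_simp
  rw [le_div_iff₀ hr]
  linarith

/-- Separate (x, φ x) from the open strict epigraph; the separating functional has negative vertical
part. -/
theorem ConvexOn.nonempty_subdifferential [FiniteDimensional ℝ E] {U : Set E} (hU : IsOpen U)
    {φ : E → ℝ} (hφ : ConvexOn ℝ U φ) {x : E} (hx : x ∈ U) :
    (approxSubdifferential U φ 0 x).Nonempty := by
  have hcont := hφ.continuousOn hU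
  have hopen : IsOpen {p : E × ℝ | p.1 ∈ U ∧ φ p.1 < p.2} := by
    rw [isOpen_iff_mem_nhds]
    rintro ⟨y, t⟩ ⟨hy, ht⟩
    have h1 : ContinuousAt (fun p : E × ℝ => φ p.1) (y, t) :=
      ContinuousAt.comp (f := Prod.fst) (hcont.continuousAt (hU.mem_nhds hy)) continuousAt_fst
    filter_upwards [continuousAt_fst.preimage_mem_nhds (hU.mem_nhds hy),
      h1.eventually_lt (g := Prod.snd) continuousAt_snd ht] with p hp hp'
    exact ⟨hp, hp'⟩
  obtain ⟨F, hF⟩ := geometric_hahn_banach_open_point hφ.convex_strict_epigraph hopen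
    (x := (x, φ x)) (by simp)
  set c : ℝ := F (0, 1) with hc
  set l : StrongDual ℝ E := F.comp (ContinuousLinearMap.inl ℝ E ℝ) with hl
  have hFl : ∀ y t, F (y, t) = l y + t * c := by
    intro y t
    have : ((y, t) : E × ℝ) = (y, 0) + t • (0, 1) := by simp
    rw [this, map_add, map_smul]
    simp [hl, hc]
  have hc0 : c < 0 := by
    have := hF (x, φ x + 1) ⟨hx, by simp⟩
    rw [hFl, hFl] at this
    linarith
  refine ⟨(-c)⁻¹ • (InnerProductSpace.toDual ℝ E).symm l, fun y hy => ?_⟩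
  have h1 : l y + φ y * c ≤ l x + φ x * c := by
    refine le_of_forall_pos_le_add fun ε hε => ?_
    have h := hF (y, φ y + ε / (-c)) ⟨hy, by
      have : 0 < ε / (-c) := div_pos hε (by linarith)
      simpa using this⟩
    rw [hFl, hFl] at h
    have : ε / (-c) * c = -ε := by rw [div_neg, neg_mul, div_mul_cancel₀ _ hc0.ne]
    linarith
  rw [real_inner_smul_left, InnerProductSpace.toDual_symm_apply, map_sub, sub_zero]
  have hc' : 0 < -c := by linarith
  have h2 : (-c)⁻¹ * (l y - l x) ≤ φ y - φ x := by
    rw [inv_mul_le_iff₀ hc']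
    linarith
  linarith

theorem gradient_add_mem_subdifferential [CompleteSpace E] {U : Set E} {f g h : E → ℝ}
    (hg : ConvexOn ℝ U g) (hf : ∀ y ∈ U, f y = g y - h y) {x η : E} (hx : x ∈ U)
    (hd : DifferentiableAt ℝ f x) (hη : η ∈ approxSubdifferential U h 0 x) :
    gradient f x + η ∈ approxSubdifferential U g 0 x := by
  intro y hy
  have h1 : HasDerivAt (fun t : ℝ => f (x + t • (y - x))) (inner ℝ (gradient f x) (y - x)) 0 := by
    have hfd := hd.hasGradientAt.hasFDerivAt
    have hlin : HasDerivAt (fun t : ℝ => x + t • (y - x)) (y - x) 0 := by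
      simpa using ((hasDerivAt_id (0 : ℝ)).smul_const (y - x)).const_add x
    have := HasFDerivAt.comp_hasDerivAt (l := f) (0 : ℝ) (by simpa using hfd) hlin
    simpa [Function.comp_def] using this
  have h2 := h1.tendsto_slope.mono_left (nhdsGT_le_nhdsNE 0)
  have h3 : inner ℝ (gradient f x) (y - x) ≤ g y - g x - inner ℝ η (y - x) := by
    refine le_of_tendsto h2 ?_
    filter_upwards [Ioo_mem_nhdsGT (zero_lt_one' ℝ)] with t ht
    have hz : x + t • (y - x) = (1 - t) • x + t • y := by module
    have hzU : x + t • (y - x) ∈ U := by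
      rw [hz]
      exact hg.1 hx hy (by linarith [ht.2]) ht.1.le (by ring)
    have h4 := hg.2 hx hy (by linarith [ht.2] : 0 ≤ 1 - t) ht.1.le (by ring)
    rw [← hz, smul_eq_mul, smul_eq_mul] at h4
    have h5 := hη _ hzU
    rw [add_sub_cancel_left, real_inner_smul_right] at h5
    rw [slope_def_field, zero_smul, add_zero, hf _ hzU, hf x hx, sub_zero, div_le_iff₀ ht.1]
    linarith
  rw [inner_add_left]
  linarith

open Metric in
/-- The Clarke differential of a difference of convex functions consists of differences of
subgradients. -/
theorem clarkeDifferential_subset_sub [FiniteDimensional ℝ E] {U : Set E} (hU : IsOpen U)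
    {f g h : E → ℝ} (hg : ConvexOn ℝ U g) (hh : ConvexOn ℝ U h)
    (hf : ∀ y ∈ U, f y = g y - h y) {x : E} (hx : x ∈ U) :
    clarkeDifferential f x ⊆ {ζ | ∃ ξ ∈ approxSubdifferential U g 0 x,
      ∃ η ∈ approxSubdifferential U h 0 x, ζ = ξ - η} := by
  refine convexHull_min ?_ ?_
  · rintro ζ ⟨u, hux, hud, huζ⟩
    have hcont : ∀ {φ}, ConvexOn ℝ U φ → Tendsto (fun i => φ (u i)) atTop (𝓝 (φ x)) := fun hφ =>
      (((hφ.continuousOn hU).continuousAt (hU.mem_nhds hx)).tendsto.comp hux)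
    obtain ⟨ρ, hρ, hρU⟩ := nhds_basis_closedBall.mem_iff.1 (hU.mem_nhds hx)
    have hs : 0 < ρ / 2 := by positivity
    have h2s : 2 * (ρ / 2) = ρ := by ring
    obtain ⟨R, hR⟩ := exists_approxSubdifferential_subset_closedBall hs
      ((hh.continuousOn hU).mono (h2s ▸ hρU))
    rw [h2s] at hR
    have huU : ∀ᶠ i in atTop, u i ∈ U := hux.eventually (hU.mem_nhds hx)
    have hub : ∀ᶠ i in atTop, u i ∈ closedBall x (ρ / 2) :=
      hux.eventually (closedBall_mem_nhds x hs)
    have hex : ∀ i, ∃ η, u i ∈ U → η ∈ approxSubdifferential U h 0 (u i) := by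
      intro i
      by_cases hi : u i ∈ U
      · exact (hh.nonempty_subdifferential hU hi).imp fun _ h _ => h
      · exact ⟨0, fun h => absurd h hi⟩
    choose η hη using hex
    have hηR : ∀ᶠ i in atTop, η i ∈ closedBall (0 : E) R := by
      filter_upwards [huU, hub] with i hi hi'
      exact hR _ hi' (approxSubdifferential_mono hρU zero_le_one _ (hη i hi))
    -- Subgradients of `h` along `u` are bounded, so a subsequence converges; adding the gradients
    -- of `f` gives subgradients of `g`, and both limits remain subgradients at `x`.
    obtain ⟨η', -, k, hk, hkη⟩ := (isCompact_closedBall (0 : E) R).tendsto_subseq' hηR.frequently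
    have hlim : ∀ {φ : E → ℝ} {v : ℕ → E} {v' : E}, ConvexOn ℝ U φ →
        (∀ i, u i ∈ U → v i ∈ approxSubdifferential U φ 0 (u i)) →
        Tendsto (v ∘ k) atTop (𝓝 v') → v' ∈ approxSubdifferential U φ 0 x := by
      intro φ v v' hφ hv hv' y hy
      have h1 := (((hcont hφ).comp hk.tendsto_atTop).add
        (hv'.inner (𝕜 := ℝ) ((tendsto_const_nhds (x := y)).sub (hux.comp hk.tendsto_atTop)))).sub_const 0
      refine le_of_tendsto h1 ?_
      filter_upwards [hk.tendsto_atTop.eventually huU] with i hi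
      exact hv _ hi y hy
    refine ⟨ζ + η', ?_, η', hlim hh hη hkη, by abel⟩
    exact hlim (v := fun i => gradient f (u i) + η i) hg
      (fun i hi => gradient_add_mem_subdifferential hg hf hi (hud i) (hη i hi))
      ((huζ.comp hk.tendsto_atTop).add hkη)
  · rintro _ ⟨ξ, hξ, η, hη, rfl⟩ _ ⟨ξ', hξ', η', hη', rfl⟩ a b ha hb hab
    exact ⟨_, convex_approxSubdifferential _ _ _ _ hξ hξ' ha hb hab, _,
      convex_approxSubdifferential _ _ _ _ hη hη' ha hb hab, by module⟩

end

/-! ### Localization and the Minkowski content -/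

section
variable {E : Type*} [NormedAddCommGroup E] [InnerProductSpace ℝ E] [FiniteDimensional ℝ E]
  [MeasurableSpace E] [BorelSpace E]

open Metric in
theorem IsDCOn.exists_nhds_volume_thickening_le {f : E → ℝ} (hf : IsDCOn Set.univ f) (x₀ : E) :
    ∃ N ∈ 𝓝 x₀, ∃ C : ENNReal, C ≠ ⊤ ∧ ∀ ε : ℝ, 0 < ε → ε ≤ 1 →
      volume (thickening ε (clarkeGraph f ∩ {q | q.fst ∈ N})) ≤
        C * ENNReal.ofReal (ε ^ Module.finrank ℝ E) := by
  obtain ⟨V, hV, -, -, g, h, hg, hh, hfgh⟩ := hf x₀ trivial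
  obtain ⟨ρ, hρ, hρV⟩ := Metric.mem_nhds_iff.1 hV
  set U := ball x₀ ρ
  have hU : IsOpen U := isOpen_ball
  replace hg := hg.subset hρV (convex_ball _ _)
  replace hh := hh.subset hρV (convex_ball _ _)
  replace hfgh : ∀ y ∈ U, f y = g y - h y := fun y hy => hfgh y (hρV hy)
  have hr : 0 < ρ / 3 := by positivity
  set W := closedBall x₀ (2 * (ρ / 3)) with hW
  have hWU : W ⊆ U := closedBall_subset_ball (by linarith)
  have hrW : closedBall x₀ (ρ / 3) ⊆ W := closedBall_subset_closedBall (by linarith)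
  set G : E → ℝ := fun y => g y + ‖y‖ ^ 2 / 2
  set H : E → ℝ := fun y => h y + ‖y‖ ^ 2 / 2
  have hstrong : ∀ {φ : E → ℝ} {x ξ}, ξ ∈ approxSubdifferential U φ 0 x →
      ξ + x ∈ strongSubdifferential W (fun y => φ y + ‖y‖ ^ 2 / 2) x := fun hξ =>
    add_self_mem_strongSubdifferential (approxSubdifferential_mono hWU le_rfl _ hξ)
  have hcont : ContinuousOn (fun y => G y + H y) W := by
    have h1 := (hg.continuousOn hU).mono hWU
    have h2 := (hh.continuousOn hU).mono hWU
    fun_prop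
  obtain ⟨R, hR⟩ := exists_approxSubdifferential_subset_closedBall hr hcont
  refine ⟨closedBall x₀ (ρ / 3), closedBall_mem_nhds _ hr,
    exists_volume_thickening_le (W := W) (G := G) (H := H) hrW
      (fun x hx => ?_) (fun x hx => ?_) hR ?_⟩
  · exact (hg.nonempty_subdifferential hU (hWU (hrW hx))).imp' _ fun _ => hstrong
  · exact (hh.nonempty_subdifferential hU (hWU (hrW hx))).imp' _ fun _ => hstrong
  · rintro q ⟨hq, hqN⟩
    obtain ⟨ξ, hξ, η, hη, hqs⟩ :=
      clarkeDifferential_subset_sub hU hg hh hfgh (hWU (hrW hqN)) hq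
    exact ⟨hqN, _, hstrong hξ, _, hstrong hη, by rw [hqs]; abel⟩

open Metric in
theorem IsDCOn.exists_volume_thickening_inter_le {f : E → ℝ} (hf : IsDCOn Set.univ f)
    {K : Set (WithLp 2 (E × E))} (hK : IsCompact K) :
    ∃ C : ENNReal, C ≠ ⊤ ∧ ∀ ε : ℝ, 0 < ε → ε ≤ 1 →
      volume (thickening ε (clarkeGraph f ∩ K)) ≤
        C * ENNReal.ofReal (ε ^ Module.finrank ℝ E) := by
  refine hK.induction_on (p := fun K => ∃ C : ENNReal, C ≠ ⊤ ∧ ∀ ε : ℝ, 0 < ε → ε ≤ 1 →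
      volume (thickening ε (clarkeGraph f ∩ K)) ≤
        C * ENNReal.ofReal (ε ^ Module.finrank ℝ E)) ⟨0, by simp, by simp⟩ ?_ ?_ ?_
  · rintro s t hst ⟨C, hC, h⟩
    exact ⟨C, hC, fun ε hε hε1 => (measure_mono (thickening_subset_of_subset ε
      (Set.inter_subset_inter_right _ hst))).trans (h ε hε hε1)⟩
  · rintro s t ⟨C, hC, h⟩ ⟨C', hC', h'⟩
    refine ⟨C + C', ENNReal.add_ne_top.2 ⟨hC, hC'⟩, fun ε hε hε1 => ?_⟩
    rw [Set.inter_union_distrib_left, thickening_union, add_mul]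
    exact (measure_union_le _ _).trans (add_le_add (h ε hε hε1) (h' ε hε hε1))
  · intro p _
    obtain ⟨N, hN, h⟩ := hf.exists_nhds_volume_thickening_le p.fst
    exact ⟨_, mem_nhdsWithin_of_mem_nhds
      ((WithLp.continuous_fst 2 E E).continuousAt.preimage_mem_nhds hN), h⟩

theorem hasFiniteContent_of_volume_thickening_le {X : Type*} [NormedAddCommGroup X]
    [InnerProductSpace ℝ X] [FiniteDimensional ℝ X] [MeasurableSpace X] [BorelSpace X] {m k : ℕ}
    (hX : Module.finrank ℝ X = m + k) {S : Set X} {C : ENNReal} (hC : C ≠ ⊤)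
    (h : ∀ ε : ℝ, 0 < ε → ε ≤ 1 →
      volume (Metric.thickening ε S) ≤ C * ENNReal.ofReal (ε ^ k)) :
    HasFiniteContent m S := by
  refine lt_of_le_of_lt (limsup_le_of_le (by isBoundedDefault) ?_) hC.lt_top
  filter_upwards [Ioo_mem_nhdsGT (by norm_num : (0 : ℝ) < 1 / 2)] with ε hε
  have h2 : 0 < 2 * ε := by linarith [hε.1]
  -- The closed ε-thickening lies in the open 2ε-thickening, whose bound cancels the normalizing
  -- power of 2ε exactly.
  calc _ ≤ ENNReal.ofReal ((2 * ε) ^ ((m : ℤ) - (Module.finrank ℝ X : ℤ))) *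
        (C * ENNReal.ofReal ((2 * ε) ^ k)) := by
        gcongr
        exact (measure_mono (Metric.cthickening_subset_thickening' h2 (by linarith [hε.1]) S)).trans
          (h _ h2 (by linarith [hε.2]))
    _ = C := by
        rw [mul_left_comm, ← ENNReal.ofReal_mul (by positivity), hX, ← zpow_natCast,
          ← zpow_add₀ h2.ne']
        simp

end

theorem mainTheorem5 (d : ℕ) (f : EuclideanSpace ℝ (Fin d) → ℝ) (hf : IsDCOn Set.univ f) :
    HasLocallyFiniteContent d (clarkeGraph f) := by
  intro K hK
  obtain ⟨C, hC, h⟩ := hf.exists_volume_thickening_inter_le hK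
  rw [finrank_euclideanSpace_fin] at h
  refine hasFiniteContent_of_volume_thickening_le (k := d) ?_ hC h
  rw [(WithLp.linearEquiv 2 ℝ _).finrank_eq, Module.finrank_prod, finrank_euclideanSpace_fin]
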